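/- **Proposition 4.2.** For each $n\ge 1$ let $p=p_n$ and $k=k_n$ be integers with $1\le k\le p$, and let $\Theta_k=\{\beta\in\mathbb R^p:\ \beta \text{ has at most } k \text{ nonzero coordinates}\}$. Consider the linear model $y=X\beta+z$ with $\beta\in\Theta_k$, where $X\in\mathbb R^{n\times p}$ has i.i.d. $\mathcal N(0,I_p)$ rows, $z\in\mathbb R^n$ has i.i.d. $\mathcal N(0,\sigma^2)$ coordinates with $\sigma>0$, and $X$ and $z$ are independent. An $\ell_0$-constrained least squares estimator is a measurable function $\hat\beta^M$ of $(X,y)$ with $$\hat\beta^M\in\operatorname*{argmin}_{b\in\Theta_k}\|y-Xb\|_2^2 .$$ Suppose that $k/p\to 0$ and $k\log(p/k)/n\to 0$ as $n\to\infty$. Then, for every real $m\ge 1$, $$\sup_{\beta\in\Theta_k}\big(\mathbb E\|\hat\beta^M-\beta\|_2^m\big)^{2/m}=O\Big(\frac{\sigma^2\,k\log(p/k)}{n}\Big)\qquad(n\to\infty).$$ That is, for every real $m\ge 1$ there is a constant $C>0$, not depending on $n$, $\sigma$ or the choice of the minimizers, such that for all sufficiently large $n$, every $\sigma>0$ and every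 $\ell_0$-constrained least squares estimator $\hat\beta^M$, $$\sup_{\beta\in\Theta_k}\big(\mathbb E\|\hat\beta^M-\beta\|_2^m\big)^{2/m}\le C\,\frac{\sigma^2\,k\log(p/k)}{n};$$ how large $n$ has to be does not depend on $\sigma$ or $\hat\beta^M$ either. -/

import Mathlib

open MeasureTheory ProbabilityTheory Filter
open scoped ENNReal NNReal Matrix

noncomputable section

namespace SparseRegression

/-- The parameter space `Θ_k` of vectors in `ℝ^p` with at most `k` nonzero coordinates. -/
def sparseVectors (p k : ℕ) : Set (EuclideanSpace ℝ (Fin p)) :=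
  {β | {i : Fin p | β i ≠ 0}.ncard ≤ k}

/-- The least squares criterion `‖y - X b‖₂²`. The vector `y - X b` is moved to Euclidean space so
that `‖ ‖` is the Euclidean norm. The `n × p` matrix `X` is given by its rows `X i = x_i`. -/
def residualSq {n p : ℕ} (X : Fin n → Fin p → ℝ) (y : Fin n → ℝ)
    (b : EuclideanSpace ℝ (Fin p)) : ℝ :=
  ‖(WithLp.toLp 2 (y - Matrix.of X *ᵥ b.ofLp) : EuclideanSpace ℝ (Fin n))‖ ^ 2

/-- `est` is an `ℓ₀`-constrained least squares estimator (MLE over `Θ_k`): a measurable function of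
the data `(X, y)` that always takes its value in `argmin_{b ∈ Θ_k} ‖y - X b‖₂²`.
Nothing is assumed on how a minimizer is selected when there are several. -/
structure IsSparseLeastSquares {n p : ℕ} (k : ℕ)
    (est : (Fin n → Fin p → ℝ) × (Fin n → ℝ) → EuclideanSpace ℝ (Fin p)) : Prop where
  measurable : Measurable est
  mem_sparse : ∀ X y, est (X, y) ∈ sparseVectors p k
  isMin : ∀ X y, IsMinOn (residualSq X y) (sparseVectors p k) (est (X, y))

/-- Isotropic Gaussian design: the `n` rows of `X` are i.i.d. `N(0, I_p)`. -/
def designLaw (n p : ℕ) : Measure (Fin n → Fin p → ℝ) :=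
  Measure.pi fun _ : Fin n => Measure.pi fun _ : Fin p => gaussianReal 0 1

/-- The noise `z = (z_1, …, z_n)` has i.i.d. `N(0, σ²)` coordinates. -/
def noiseLaw (n : ℕ) (σ : ℝ) : Measure (Fin n → ℝ) :=
  Measure.pi fun _ : Fin n => gaussianReal 0 (Real.toNNReal (σ ^ 2))

/-- The moment `E ‖β̂ - β‖₂^m` of the error of the estimator `est` in the model `y = X β + z`, where
`X` and `z` are independent; it is a value in `[0, ∞]`. -/
def errorMoment {n p : ℕ}
    (est : (Fin n → Fin p → ℝ) × (Fin n → ℝ) → EuclideanSpace ℝ (Fin p))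
    (σ m : ℝ) (β : EuclideanSpace ℝ (Fin p)) : ℝ≥0∞ :=
  ∫⁻ w, ‖est (w.1, Matrix.of w.1 *ᵥ β.ofLp + w.2) - β‖ₑ ^ m ∂((designLaw n p).prod (noiseLaw n σ))

end SparseRegression

end

namespace SparseRegression

/-! The error `h = est - β` is supported on a set `S` of `2k` columns. Minimality gives `‖z - X h‖ ≤
‖z‖`, hence `‖X h‖ ≤ 2 ‖P_S z‖`, with `P_S` the projection on the span of these columns. The proof
thus needs an upper bound for the projected noise and a lower bound for `‖X h‖ / ‖h‖`, both uniform
in `S` and both in moments: a high-probability bound alone would not control `E ‖h‖^m` on the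
exceptional event.

Noise: for fixed `X`, `E exp(‖P_S z‖² / 4σ²) ≤ 2^(2k)`. With `L = 4 k log(p/k)` one has `choose p
(2k) * 2^(2k) ≤ exp L`, so summing over `S` bounds the `m`-th moment of the largest projection by a
multiple of `(σ√L)^m`.

Design: if a unit vector `v` has `‖X_S v‖² ≤ n b²`, then on at least half of a small ball around `v`
the product of `|⟨x_i, u⟩|^(-1/4)` over the rows is at least `(3b²)^(-n/8)`. Integrating this
product over a shell gives a random variable `singularBound` that dominates `b^(-n/8)` for every
such `v` at once (`ofReal_rpow_le_singularBound`). No net is needed, and the expectation is at most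
`growthRate ^ n` because a Gaussian has a finite moment of order `-1/2`
(`lintegral_singularBound_le`). The sum over `S` costs a factor at most `3^n`, and Jensen with
exponent `8m/n` turns `(3 * growthRate)^n` into a constant independent of `n`.

`enorm_rpow_le_mul_singularBound` joins the two bounds pointwise; `errorMoment_le` integrates, first
over `z` given `X`. -/

/-! ### Gaussian integrals -/

theorem lintegral_pi_prod {ι : Type*} [Fintype ι] {Ω : ι → Type*} [∀ i, MeasurableSpace (Ω i)]
    (μ : ∀ i, Measure (Ω i)) [∀ i, IsProbabilityMeasure (μ i)] (f : ∀ i, Ω i → ℝ≥0∞)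
    (hf : ∀ i, Measurable (f i)) :
    ∫⁻ x, ∏ i, f i (x i) ∂(Measure.pi μ) = ∏ i, ∫⁻ t, f i t ∂(μ i) := by
  rw [lintegral_prod_eq_prod_lintegral_of_indepFun Finset.univ (fun i (x : ∀ i, Ω i) => f i (x i))
    (iIndepFun_pi fun i => (hf i).aemeasurable)
    (fun i => (hf i).comp (measurable_pi_apply i))]
  refine Finset.prod_congr rfl fun i _ => ?_
  exact (measurePreserving_eval μ i).lintegral_comp (hf i)

theorem lintegral_rpow_le_rpow_lintegral {α : Type*} [MeasurableSpace α] {μ : Measure α}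
    [IsProbabilityMeasure μ] {f : α → ℝ≥0∞} (hf : AEMeasurable f μ) {θ : ℝ} (h0 : 0 ≤ θ)
    (h1 : θ ≤ 1) : ∫⁻ a, f a ^ θ ∂μ ≤ (∫⁻ a, f a ∂μ) ^ θ := by
  have h := ENNReal.lintegral_mul_norm_pow_le (μ := μ) hf (g := fun _ => 1) aemeasurable_const
    h0 (sub_nonneg.2 h1) (by ring)
  simpa using h

theorem lintegral_exp_sq_div_four :
    ∫⁻ x, ENNReal.ofReal (Real.exp (x ^ 2 / 4)) ∂(gaussianReal 0 1) ≤ 2 := by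
  rw [gaussianReal_of_var_ne_zero _ one_ne_zero, lintegral_withDensity_eq_lintegral_mul _
    (measurable_gaussianPDF 0 1) (by fun_prop)]
  have h1 : ∀ x : ℝ, (gaussianPDF 0 1 * fun x : ℝ => ENNReal.ofReal (Real.exp (x ^ 2 / 4))) x
      = ENNReal.ofReal ((√(2 * Real.pi))⁻¹ * Real.exp (-(1/4) * x ^ 2)) := by
    intro x
    simp only [Pi.mul_apply, gaussianPDF, gaussianPDFReal]
    rw [← ENNReal.ofReal_mul (by positivity)]
    congr 1
    rw [mul_assoc, ← Real.exp_add]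
    simp only [NNReal.coe_one, mul_one]
    congr 2
    ring
  simp_rw [h1]
  rw [← ofReal_integral_eq_lintegral_ofReal
    ((integrable_exp_neg_mul_sq (by norm_num)).const_mul _)
    (Eventually.of_forall fun x => by positivity), integral_const_mul, integral_gaussian]
  rw [show (2 : ℝ≥0∞) = ENNReal.ofReal 2 by simp]
  refine ENNReal.ofReal_le_ofReal ?_
  rw [inv_mul_le_iff₀ (by positivity), show (2:ℝ) = √4 by
    rw [show (4:ℝ) = 2 ^ 2 by norm_num]; simp, ← Real.sqrt_mul (by positivity)]
  refine Real.sqrt_le_sqrt ?_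
  rw [show (4:ℝ) = 2 ^ 2 by norm_num]; simp
  linarith [Real.pi_pos]

/-- The density is at most `1` and `|x|^(-1/2)` is integrable near `0`; off `(-1, 1]` the integrand
is at most `1`. -/
theorem lintegral_enorm_rpow_gaussianReal_ne_top :
    ∫⁻ x : ℝ, ‖x‖ₑ ^ (-(1/2) : ℝ) ∂(gaussianReal 0 1) ≠ ∞ := by
  have hint : IntegrableOn (fun x : ℝ => |x| ^ (-(1/2) : ℝ)) (Set.Ioc (-1) 1) := by
    rw [← intervalIntegrable_iff_integrableOn_Ioc_of_le (by norm_num)]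
    refine intervalIntegrable_of_even (fun x => by simp) fun x hx => ?_
    refine (intervalIntegral.intervalIntegrable_rpow' (r := -(1/2)) (by norm_num)).congr ?_
    intro t ht
    rw [Set.uIoc_of_le hx.le] at ht
    simp [abs_of_pos ht.1]
  have h1 : ∫⁻ x in Set.Ioc (-1 : ℝ) 1, ‖x‖ₑ ^ (-(1/2) : ℝ) ≠ ∞ := by
    refine ((lintegral_congr_ae ?_).trans_lt hint.2).ne
    have : ∀ᵐ x : ℝ ∂(volume.restrict (Set.Ioc (-1 : ℝ) 1)), x ≠ 0 :=
      ae_restrict_of_ae (Measure.ae_ne volume 0)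
    filter_upwards [this] with x hx
    rw [Real.enorm_eq_ofReal_abs, Real.enorm_eq_ofReal_abs, ENNReal.ofReal_rpow_of_pos (by positivity)]
    rw [abs_of_nonneg (a := |x| ^ _) (by positivity)]
  refine ne_top_of_le_ne_top (b := (∫⁻ x in Set.Ioc (-1 : ℝ) 1, ‖x‖ₑ ^ (-(1/2) : ℝ)) + 1)
    (ENNReal.add_ne_top.2 ⟨h1, ENNReal.one_ne_top⟩) ?_
  have hpdf : ∀ x, gaussianPDF 0 1 x ≤ 1 := by
    intro x
    simp only [gaussianPDF, gaussianPDFReal]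
    rw [ENNReal.ofReal_le_one]
    refine mul_le_one₀ ?_ (Real.exp_pos _).le ?_
    · refine inv_le_one_of_one_le₀ ?_
      rw [Real.one_le_sqrt]
      simp
      linarith [Real.pi_gt_three]
    · rw [Real.exp_le_one_iff]
      exact div_nonpos_of_nonpos_of_nonneg (neg_nonpos.2 (sq_nonneg _)) (by simp)
  rw [← lintegral_add_compl _ (measurableSet_Ioc (a := (-1:ℝ)) (b := 1))]
  gcongr
  · rw [gaussianReal_of_var_ne_zero _ one_ne_zero]
    exact (withDensity_mono (ae_of_all _ hpdf)).trans_eq withDensity_one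
  · calc _ ≤ ∫⁻ x in (Set.Ioc (-1 : ℝ) 1)ᶜ, 1 ∂(gaussianReal 0 1) := by
          refine setLIntegral_mono measurable_const fun x hx => ?_
          refine ENNReal.rpow_le_one_of_one_le_of_neg ?_ (by norm_num)
          rw [Real.enorm_eq_ofReal_abs, ENNReal.one_le_ofReal]
          by_contra hlt
          rw [not_le, abs_lt] at hlt
          exact hx ⟨hlt.1, hlt.2.le⟩
      _ ≤ 1 := by simpa using prob_le_one

/-- The law of a linear form of a standard Gaussian vector. -/
theorem map_sum_mul_pi_gaussianReal {ι : Type*} [Fintype ι] (c : EuclideanSpace ℝ ι) :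
    (Measure.pi fun _ : ι => gaussianReal 0 1).map (fun x => ∑ j, x j * c j)
      = (gaussianReal 0 1).map (fun t => ‖c‖ * t) := by
  have h1 : (fun x : ι → ℝ => ∑ j, x j * c j)
      = (innerSL ℝ c : EuclideanSpace ℝ ι →L[ℝ] ℝ) ∘ (WithLp.toLp 2) := by
    ext x
    simp [PiLp.inner_apply]
  rw [h1, ← Measure.map_map (by fun_prop) (by fun_prop), map_pi_eq_stdGaussian,
    IsGaussian.map_eq_gaussianReal, integral_strongDual_stdGaussian, variance_dual_stdGaussian,
    gaussianReal_map_const_mul, innerSL_apply_norm]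
  congr 1
  · simp
  · ext; simp [Real.toNNReal_of_nonneg]

theorem lintegral_enorm_sum_mul_rpow {ι : Type*} [Fintype ι] (c : EuclideanSpace ℝ ι)
    (q : ℝ) :
    ∫⁻ x, ‖∑ j, x j * c j‖ₑ ^ q ∂(Measure.pi fun _ : ι => gaussianReal 0 1)
      = ‖c‖ₑ ^ q * ∫⁻ x : ℝ, ‖x‖ₑ ^ q ∂(gaussianReal 0 1) := by
  rw [← lintegral_map (f := fun t : ℝ => ‖t‖ₑ ^ q) (g := fun x : ι → ℝ => ∑ j, x j * c j)
    (by fun_prop) (by fun_prop), map_sum_mul_pi_gaussianReal,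
    lintegral_map (by fun_prop) (by fun_prop), ← lintegral_const_mul _ (by fun_prop)]
  refine lintegral_congr fun t => ?_
  rw [enorm_mul, ENNReal.mul_rpow_of_ne_top (by simp) (by simp)]
  simp

theorem lintegral_exp_sum_mul {ι : Type*} [Fintype ι] (v : ℝ≥0) (c : ι → ℝ) :
    ∫⁻ z, ENNReal.ofReal (Real.exp (∑ i, c i * z i)) ∂(Measure.pi fun _ : ι => gaussianReal 0 v)
      = ENNReal.ofReal (Real.exp (v * (∑ i, c i ^ 2) / 2)) := by
  have h1 : ∀ z : ι → ℝ, ENNReal.ofReal (Real.exp (∑ i, c i * z i))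
      = ∏ i, ENNReal.ofReal (Real.exp (c i * z i)) := fun z => by
    rw [Real.exp_sum, ENNReal.ofReal_prod_of_nonneg fun i _ => (Real.exp_pos _).le]
  simp_rw [h1]
  rw [lintegral_pi_prod (fun _ => gaussianReal 0 v)
    (fun i t => ENNReal.ofReal (Real.exp (c i * t))) (fun i => by fun_prop), Finset.mul_sum,
    Finset.sum_div, Real.exp_sum, ENNReal.ofReal_prod_of_nonneg fun i _ => (Real.exp_pos _).le]
  refine Finset.prod_congr rfl fun i _ => ?_
  rw [← ofReal_integral_eq_lintegral_ofReal (integrable_exp_mul_gaussianReal _)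
    (Eventually.of_forall fun x => (Real.exp_pos _).le)]
  have := mgf_gaussianReal (p := gaussianReal 0 v) (X := id) (μ := 0) (v := v) (by simp) (c i)
  simp only [mgf, id] at this
  rw [this]
  simp

/-! ### Projected noise -/

/-- Linearization of the square: `exp(s²/2) = E exp(s g)` for an auxiliary standard Gaussian `g`.
After exchanging the integrals, the exponent is linear in `z`, and orthonormality reduces the
integral over `z` to a product of `exp(g_i²/4)`. -/
theorem lintegral_exp_sum_inner_sq_le {n : ℕ} {ι : Type*} [Fintype ι]
    {u : ι → EuclideanSpace ℝ (Fin n)} (hu : Orthonormal ℝ u) {σ : ℝ} (hσ : 0 < σ) :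
    ∫⁻ z, ENNReal.ofReal (Real.exp ((∑ i, (inner ℝ (u i) (WithLp.toLp 2 z)) ^ 2) / (4 * σ ^ 2)))
      ∂(noiseLaw n σ) ≤ 2 ^ Fintype.card ι := by
  have hs : (√2) ^ 2 = 2 := Real.sq_sqrt (by norm_num)
  have hlin : ∀ z : Fin n → ℝ,
      ENNReal.ofReal (Real.exp ((∑ i, (inner ℝ (u i) (WithLp.toLp 2 z)) ^ 2) / (4 * σ ^ 2)))
      = ∫⁻ g, ENNReal.ofReal (Real.exp (∑ i, (inner ℝ (u i) (WithLp.toLp 2 z) / (√2 * σ)) * g i))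
        ∂(Measure.pi fun _ : ι => gaussianReal 0 1) := by
    intro z
    rw [lintegral_exp_sum_mul]
    congr 2
    simp only [div_pow, mul_pow, hs, ← Finset.sum_div, NNReal.coe_one, one_mul]
    field_simp
    ring
  simp_rw [hlin]
  unfold noiseLaw
  rw [lintegral_lintegral_swap]
  swap
  · refine Measurable.aemeasurable ?_
    simp only [PiLp.inner_apply]
    fun_prop
  have hz : ∀ g : ι → ℝ, ∫⁻ z : Fin n → ℝ,
      ENNReal.ofReal (Real.exp (∑ i, (inner ℝ (u i) (WithLp.toLp 2 z) / (√2 * σ)) * g i))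
        ∂(Measure.pi fun _ : Fin n => gaussianReal 0 (Real.toNNReal (σ ^ 2)))
      = ∏ i, ENNReal.ofReal (Real.exp (g i ^ 2 / 4)) := by
    intro g
    set w : EuclideanSpace ℝ (Fin n) := ∑ i, g i • u i with hw
    have h1 : ∀ z : Fin n → ℝ, ∑ i, (inner ℝ (u i) (WithLp.toLp 2 z) / (√2 * σ)) * g i
        = ∑ j, (w j / (√2 * σ)) * z j := by
      intro z
      have h2 : inner ℝ w (WithLp.toLp 2 z) = ∑ i, inner ℝ (u i) (WithLp.toLp 2 z) * g i := by
        rw [hw, sum_inner]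
        refine Finset.sum_congr rfl fun i _ => ?_
        rw [real_inner_smul_left, mul_comm]
      have h3 : inner ℝ w (WithLp.toLp 2 z) = ∑ j, w j * z j := by
        rw [PiLp.inner_apply]
        refine Finset.sum_congr rfl fun j _ => ?_
        simp [mul_comm]
      simp_rw [div_mul_eq_mul_div, ← Finset.sum_div]
      rw [← h2, h3]
    simp_rw [h1]
    rw [lintegral_exp_sum_mul, ← ENNReal.ofReal_prod_of_nonneg fun i _ => (Real.exp_pos _).le,
      ← Real.exp_sum]
    congr 2
    have h4 : ∑ j, w j ^ 2 = ∑ i, g i ^ 2 := by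
      rw [← EuclideanSpace.real_norm_sq_eq, ← real_inner_self_eq_norm_sq, hw, hu.inner_sum]
      simp [sq]
    rw [Real.coe_toNNReal _ (sq_nonneg σ)]
    simp only [div_pow, mul_pow, hs, ← Finset.sum_div, h4]
    field_simp
    ring
  simp_rw [hz]
  rw [lintegral_pi_prod (fun _ : ι => gaussianReal 0 1)
    (fun _ t => ENNReal.ofReal (Real.exp (t ^ 2 / 4))) (fun _ => by fun_prop)]
  refine (Finset.prod_le_prod' fun i _ => lintegral_exp_sq_div_four).trans ?_
  simp

theorem norm_starProjection_sq {E : Type*} [NormedAddCommGroup E] [InnerProductSpace ℝ E]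
    (V : Submodule ℝ E) [FiniteDimensional ℝ V] (z : E) :
    ‖V.starProjection z‖ ^ 2
      = ∑ i, (inner ℝ (stdOrthonormalBasis ℝ V i : E) z) ^ 2 := by
  rw [Submodule.starProjection_apply, ← Submodule.coe_norm,
    ← OrthonormalBasis.sum_sq_norm_inner_right (stdOrthonormalBasis ℝ V)]
  refine Finset.sum_congr rfl fun i _ => ?_
  rw [Submodule.inner_orthogonalProjectionOnto_eq_of_mem_left]
  simp

/-- Exponential moment of the squared norm of the projection of the noise on a subspace. -/
theorem lintegral_exp_norm_starProjection_sq_le {n : ℕ}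
    (V : Submodule ℝ (EuclideanSpace ℝ (Fin n))) {σ : ℝ} (hσ : 0 < σ) :
    ∫⁻ z, ENNReal.ofReal (Real.exp (‖V.starProjection (WithLp.toLp 2 z)‖ ^ 2 / (4 * σ ^ 2)))
      ∂(noiseLaw n σ) ≤ 2 ^ Module.finrank ℝ V := by
  simp_rw [norm_starProjection_sq]
  refine (lintegral_exp_sum_inner_sq_le (u := fun i => (stdOrthonormalBasis ℝ V i :
    EuclideanSpace ℝ (Fin n))) ?_ hσ).trans_eq (by simp)
  exact (stdOrthonormalBasis ℝ V).orthonormal.comp_linearIsometry V.subtypeₗᵢ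

/-- Expanding the square gives `‖v‖² ≤ 2⟨z, v⟩ = 2⟨P z, v⟩`; then Cauchy–Schwarz. -/
theorem norm_le_two_mul_norm_starProjection {E : Type*} [NormedAddCommGroup E]
    [InnerProductSpace ℝ E] (V : Submodule ℝ E) [FiniteDimensional ℝ V] {v z : E} (hv : v ∈ V)
    (h : ‖z - v‖ ^ 2 ≤ ‖z‖ ^ 2) : ‖v‖ ≤ 2 * ‖V.starProjection z‖ := by
  have h1 : inner ℝ z v = inner ℝ (V.starProjection z) v := by
    rw [Submodule.inner_starProjection_left_eq_right, Submodule.starProjection_eq_self_iff.2 hv]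
  have h2 := real_inner_le_norm (V.starProjection z) v
  rw [norm_sub_sq_real, h1] at h
  have h3 : ‖v‖ * ‖v‖ ≤ (2 * ‖V.starProjection z‖) * ‖v‖ := by nlinarith
  rcases (norm_nonneg v).eq_or_lt with h0 | h0
  · rw [← h0]; positivity
  · exact le_of_mul_le_mul_right h3 h0

/-! ### Pointwise control of the smallest singular value -/

variable {ι : Type*} [Fintype ι]

/-- The reflection exchanging `x` and `y` preserves Lebesgue measure and the ball. -/
theorem setLIntegral_ball_inner_sq_congr {x y : EuclideanSpace ℝ ι} (h : ‖x‖ = ‖y‖) (r : ℝ) :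
    ∫⁻ u in Metric.ball (0 : EuclideanSpace ℝ ι) r, ENNReal.ofReal ((inner ℝ x u) ^ 2)
      = ∫⁻ u in Metric.ball (0 : EuclideanSpace ℝ ι) r, ENNReal.ofReal ((inner ℝ y u) ^ 2) := by
  set ρ := (ℝ ∙ (x - y))ᗮ.reflection with hρ
  have hxy : ρ x = y := Submodule.reflection_sub h
  have hpre : ρ ⁻¹' (Metric.ball 0 r) = Metric.ball 0 r := by
    rw [LinearIsometryEquiv.preimage_ball]; simp
  have h1 := ρ.measurePreserving.setLIntegral_comp_preimage
    (s := Metric.ball 0 r) measurableSet_ball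
    (f := fun u => ENNReal.ofReal ((inner ℝ y u) ^ 2)) (by fun_prop)
  rw [hpre] at h1
  rw [← h1]
  refine lintegral_congr fun u => ?_
  rw [← hxy, LinearIsometryEquiv.inner_map_map]

/-- By rotation invariance `x` may be replaced by `‖x‖ e_i` for each `i`; the sum over `i` produces
`‖x‖² ‖u‖²`, and `‖u‖ < r` on the ball. -/
theorem card_mul_setLIntegral_ball_inner_sq_le (x : EuclideanSpace ℝ ι) {r : ℝ} :
    Fintype.card ι * ∫⁻ u in Metric.ball (0 : EuclideanSpace ℝ ι) r,
        ENNReal.ofReal ((inner ℝ x u) ^ 2)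
      ≤ ENNReal.ofReal (‖x‖ ^ 2 * r ^ 2) * volume (Metric.ball (0 : EuclideanSpace ℝ ι) r) := by
  classical
  have h1 : ∀ i, ∫⁻ u in Metric.ball (0 : EuclideanSpace ℝ ι) r, ENNReal.ofReal ((inner ℝ x u) ^ 2)
      = ENNReal.ofReal (‖x‖ ^ 2) *
        ∫⁻ u in Metric.ball (0 : EuclideanSpace ℝ ι) r, ENNReal.ofReal (u i ^ 2) := by
    intro i
    rw [setLIntegral_ball_inner_sq_congr (y := ‖x‖ • EuclideanSpace.single i (1 : ℝ))
      (by simp [norm_smul]), ← lintegral_const_mul _ (by fun_prop)]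
    refine lintegral_congr fun u => ?_
    rw [← ENNReal.ofReal_mul (by positivity), real_inner_smul_left, mul_pow]
    simp [EuclideanSpace.inner_single_left]
  calc _ = ∑ i : ι, ∫⁻ u in Metric.ball (0 : EuclideanSpace ℝ ι) r,
        ENNReal.ofReal ((inner ℝ x u) ^ 2) := by simp
    _ = ENNReal.ofReal (‖x‖ ^ 2) *
        ∫⁻ u in Metric.ball (0 : EuclideanSpace ℝ ι) r, ENNReal.ofReal (‖u‖ ^ 2) := by
      rw [Finset.sum_congr rfl fun i _ => h1 i, ← Finset.mul_sum,
        ← lintegral_finsetSum _ (fun i _ => by fun_prop)]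
      congr 1
      refine lintegral_congr fun u => ?_
      rw [EuclideanSpace.real_norm_sq_eq, ENNReal.ofReal_sum_of_nonneg fun i _ => sq_nonneg _]
    _ ≤ ENNReal.ofReal (‖x‖ ^ 2) *
        ∫⁻ u in Metric.ball (0 : EuclideanSpace ℝ ι) r, ENNReal.ofReal (r ^ 2) := by
      refine mul_le_mul_right (setLIntegral_mono measurable_const fun u hu =>
        ENNReal.ofReal_le_ofReal ?_) _
      have : ‖u‖ < r := by simpa using hu
      gcongr
    _ = _ := by
      rw [setLIntegral_const, ENNReal.ofReal_mul (by positivity), mul_assoc]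

/-- At least half of a centred ball consists of points at which a quadratic form does not exceed
twice its trace average. -/
theorem volume_ball_le_two_mul {κ : Type*} [Fintype κ] (x : κ → EuclideanSpace ℝ ι) {r t : ℝ}
    (ht : 0 < t) [Nonempty ι] (h : 2 * ((∑ i, ‖x i‖ ^ 2) * r ^ 2) ≤ Fintype.card ι * t) :
    volume (Metric.ball (0 : EuclideanSpace ℝ ι) r)
      ≤ 2 * volume (Metric.ball (0 : EuclideanSpace ℝ ι) r ∩ {u | ∑ i, (inner ℝ (x i) u) ^ 2 ≤ t}) := by
  set B := Metric.ball (0 : EuclideanSpace ℝ ι) r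
  set G := {u : EuclideanSpace ℝ ι | ∑ i, (inner ℝ (x i) u) ^ 2 ≤ t} with hG
  have hGm : MeasurableSet G := measurableSet_le (by fun_prop) measurable_const
  have hBfin : volume B ≠ ∞ := measure_ball_lt_top.ne
  have hsum : Fintype.card ι * ∫⁻ u in B, ENNReal.ofReal (∑ i, (inner ℝ (x i) u) ^ 2)
      ≤ ENNReal.ofReal ((∑ i, ‖x i‖ ^ 2) * r ^ 2) * volume B := by
    simp_rw [ENNReal.ofReal_sum_of_nonneg fun i (_ : i ∈ Finset.univ) =>
      sq_nonneg (inner ℝ (x i) _)]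
    rw [lintegral_finsetSum _ (fun i _ => by fun_prop), Finset.mul_sum, Finset.sum_mul,
      ENNReal.ofReal_sum_of_nonneg fun i _ => by positivity, Finset.sum_mul]
    exact Finset.sum_le_sum fun i _ => card_mul_setLIntegral_ball_inner_sq_le (x i)
  -- Markov's inequality for the quadratic form on the ball.
  have hmark : ENNReal.ofReal t * volume (B \ G)
      ≤ ∫⁻ u in B, ENNReal.ofReal (∑ i, (inner ℝ (x i) u) ^ 2) := by
    rw [← setLIntegral_const]
    calc _ ≤ ∫⁻ u in B \ G, ENNReal.ofReal (∑ i, (inner ℝ (x i) u) ^ 2) := by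
          refine setLIntegral_mono (by fun_prop) fun u hu => ENNReal.ofReal_le_ofReal ?_
          exact (not_le.1 hu.2).le
      _ ≤ _ := lintegral_mono_set Set.sdiff_subset
  have hc : (0 : ℝ) < Fintype.card ι := by exact_mod_cast Fintype.card_pos
  have h2 : 2 * volume (B \ G) ≤ volume B := by
    have h3 : ENNReal.ofReal (Fintype.card ι * t) * (2 * volume (B \ G))
        ≤ ENNReal.ofReal (Fintype.card ι * t) * volume B := by
      calc ENNReal.ofReal (Fintype.card ι * t) * (2 * volume (B \ G))
          = 2 * (Fintype.card ι * (ENNReal.ofReal t * volume (B \ G))) := by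
            rw [ENNReal.ofReal_mul hc.le, ENNReal.ofReal_natCast]; ring
        _ ≤ 2 * (ENNReal.ofReal ((∑ i, ‖x i‖ ^ 2) * r ^ 2) * volume B) := by
            exact mul_le_mul_right ((mul_le_mul_right hmark _).trans hsum) _
        _ = ENNReal.ofReal (2 * ((∑ i, ‖x i‖ ^ 2) * r ^ 2)) * volume B := by
            rw [ENNReal.ofReal_mul (by norm_num : (0:ℝ) ≤ 2), mul_assoc]; simp
        _ ≤ _ := by gcongr
    exact (ENNReal.mul_le_mul_iff_right (ENNReal.ofReal_pos.2 (by positivity)).ne'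
      ENNReal.ofReal_ne_top).1 h3
  have h4 : volume (B ∩ G) + volume (B \ G) = volume B := measure_inter_add_sdiff B hGm
  have h5 : volume (B \ G) ≠ ∞ := ne_top_of_le_ne_top hBfin (measure_mono Set.sdiff_subset)
  have h6 : volume (B \ G) ≤ volume (B ∩ G) := by
    rw [← h4, two_mul] at h2
    exact (ENNReal.add_le_add_iff_right h5).1 h2
  rw [← h4, two_mul]
  gcongr

/-- This is `log s ≤ s - 1` at `s = a²/τ`. It linearizes the logarithm of the product, so the next
lemma is an AM–GM inequality. At `a = 0` the right side is `∞`. -/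
theorem ofReal_le_enorm_rpow {τ : ℝ} (hτ : 0 < τ) (a : ℝ) :
    ENNReal.ofReal (Real.exp ((1 - a ^ 2 / τ - Real.log τ) / 8)) ≤ ‖a‖ₑ ^ (-(1/4) : ℝ) := by
  rcases eq_or_ne a 0 with rfl | ha
  · simp
  have ha' : 0 < |a| := abs_pos.2 ha
  rw [Real.enorm_eq_ofReal_abs, ENNReal.ofReal_rpow_of_pos ha', Real.rpow_def_of_pos ha']
  refine ENNReal.ofReal_le_ofReal (Real.exp_le_exp.2 ?_)
  have h1 := Real.log_le_sub_one_of_pos (x := a ^ 2 / τ) (by positivity)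
  rw [Real.log_div (by positivity) hτ.ne', ← sq_abs a, Real.log_pow, sq_abs] at h1
  push_cast at h1
  linarith

theorem ofReal_rpow_le_prod_enorm_rpow {κ : Type*} [Fintype κ] {τ : ℝ} (hτ : 0 < τ) (a : κ → ℝ)
    (h : ∑ i, a i ^ 2 ≤ Fintype.card κ * τ) :
    ENNReal.ofReal (τ ^ (-(Fintype.card κ / 8) : ℝ)) ≤ ∏ i, ‖a i‖ₑ ^ (-(1/4) : ℝ) := by
  refine le_trans ?_ (Finset.prod_le_prod' fun i _ => ofReal_le_enorm_rpow hτ (a i))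
  rw [← ENNReal.ofReal_prod_of_nonneg fun i _ => (Real.exp_pos _).le, ← Real.exp_sum,
    Real.rpow_def_of_pos hτ]
  refine ENNReal.ofReal_le_ofReal (Real.exp_le_exp.2 ?_)
  rw [← Finset.sum_div, Finset.sum_sub_distrib, Finset.sum_sub_distrib, ← Finset.sum_div]
  simp only [Finset.sum_const, Finset.card_univ, nsmul_eq_mul, mul_one]
  have : (∑ i, a i ^ 2) / τ ≤ Fintype.card κ := (div_le_iff₀ hτ).2 h
  linarith

/-- A spherical shell around the unit sphere. -/
def shell (ι : Type*) [Fintype ι] : Set (EuclideanSpace ℝ ι) :=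
  Metric.ball 0 (3/2) ∩ {u | 1/2 ≤ ‖u‖}

theorem measurableSet_shell : MeasurableSet (shell ι) :=
  measurableSet_ball.inter (measurableSet_le measurable_const (by fun_prop))

/-- The integral over a shell of the product of the negative powers of the linear forms. -/
noncomputable def shellIntegral {n : ℕ} (x : Fin n → EuclideanSpace ℝ ι) : ℝ≥0∞ :=
  ∫⁻ u in shell ι, ∏ i, ‖inner ℝ (x i) u‖ₑ ^ (-(1/4) : ℝ)

/-- The ball of radius `r ≤ 1/2` around `v` lies in the shell. On half of it the perturbation `u`
contributes at most `n b²/2`, so `(s + t)² ≤ 2s² + 2t²` bounds the form at `v + u` by `2nb² + nb² =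
3nb²`. -/
theorem mul_volume_ball_le_shellIntegral [Nonempty ι] {n : ℕ} (hn : 0 < n)
    (x : Fin n → EuclideanSpace ℝ ι)
    {v : EuclideanSpace ℝ ι} (hv : ‖v‖ = 1) {b r : ℝ} (hb : 0 < b) (hr : r ≤ 1/2)
    (hxv : ∑ i, (inner ℝ (x i) v) ^ 2 ≤ n * b ^ 2)
    (hxr : 4 * ((∑ i, ‖x i‖ ^ 2) * r ^ 2) ≤ Fintype.card ι * (n * b ^ 2)) :
    ENNReal.ofReal ((3 * b ^ 2) ^ (-(n / 8) : ℝ)) * volume (Metric.ball (0 : EuclideanSpace ℝ ι) r)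
      ≤ 2 * shellIntegral x := by
  have hn' : (0 : ℝ) < n := by exact_mod_cast hn
  have hhalf := volume_ball_le_two_mul x (r := r) (t := n * b ^ 2 / 2) (by positivity)
    (by linarith)
  set A := Metric.ball (0 : EuclideanSpace ℝ ι) r ∩
    {u | ∑ i, (inner ℝ (x i) u) ^ 2 ≤ n * b ^ 2 / 2} with hA
  have hAm : MeasurableSet A :=
    measurableSet_ball.inter (measurableSet_le (by fun_prop) measurable_const)
  set A' := (fun u => v + u) '' A with hA'
  have hvol : volume A' = volume A := by
    simp [hA', Set.image_add_left]
  have hAm' : MeasurableSet A' := (measurableEmbedding_addLeft v).measurableSet_image.2 hAm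
  have hsub : A' ⊆ shell ι := by
    rintro _ ⟨u, ⟨hu, -⟩, rfl⟩
    rw [mem_ball_zero_iff] at hu
    refine ⟨?_, ?_⟩
    · rw [mem_ball_zero_iff]
      linarith [norm_add_le v u]
    · have := norm_sub_le (v + u) u
      rw [add_sub_cancel_right] at this
      simp only [Set.mem_ofPred_eq]
      linarith
  have hlow : ∀ u ∈ A', ENNReal.ofReal ((3 * b ^ 2) ^ (-(n / 8) : ℝ))
      ≤ ∏ i, ‖inner ℝ (x i) u‖ₑ ^ (-(1/4) : ℝ) := by
    rintro _ ⟨u, ⟨-, hu⟩, rfl⟩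
    have := ofReal_rpow_le_prod_enorm_rpow (τ := 3 * b ^ 2) (by positivity)
      (fun i => inner ℝ (x i) (v + u)) ?_
    · simpa using this
    · calc ∑ i, (inner ℝ (x i) (v + u)) ^ 2
          ≤ ∑ i, (2 * (inner ℝ (x i) v) ^ 2 + 2 * (inner ℝ (x i) u) ^ 2) := by
            refine Finset.sum_le_sum fun i _ => ?_
            rw [inner_add_right]
            nlinarith [sq_nonneg (inner ℝ (x i) v - inner ℝ (x i) u)]
        _ = 2 * ∑ i, (inner ℝ (x i) v) ^ 2 + 2 * ∑ i, (inner ℝ (x i) u) ^ 2 := by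
            rw [Finset.sum_add_distrib, Finset.mul_sum, Finset.mul_sum]
        _ ≤ _ := by
            simp only [Set.mem_ofPred_eq] at hu
            simp only [Fintype.card_fin]
            linarith
  calc _ ≤ ENNReal.ofReal ((3 * b ^ 2) ^ (-(n / 8) : ℝ)) * (2 * volume A) :=
        mul_le_mul_right hhalf _
    _ = 2 * ∫⁻ u in A', ENNReal.ofReal ((3 * b ^ 2) ^ (-(n / 8) : ℝ)) := by
        rw [setLIntegral_const, hvol]; ring
    _ ≤ 2 * ∫⁻ u in A', ∏ i, ‖inner ℝ (x i) u‖ₑ ^ (-(1/4) : ℝ) :=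
        mul_le_mul_right (setLIntegral_mono' hAm' hlow) _
    _ ≤ _ := mul_le_mul_right (lintegral_mono_set hsub) _

/-- A random variable controlling the inverse of the smallest singular value of the design
with rows `x i`. -/
noncomputable def singularBound {n : ℕ} (x : Fin n → EuclideanSpace ℝ ι) : ℝ≥0∞ :=
  1 + ENNReal.ofReal (3 ^ (n / 8 : ℝ) * 2 ^ (Fintype.card ι + 1))
    * (ENNReal.ofReal (Real.exp ((∑ i, ‖x i‖ ^ 2) / (2 * n)))
      * ((volume (Metric.ball (0 : EuclideanSpace ℝ ι) 1))⁻¹ * shellIntegral x))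

theorem ofReal_rpow_le_singularBound [Nonempty ι] {n : ℕ} (hn : 0 < n)
    (hd : (Fintype.card ι : ℝ) ≤ n / 8)
    (x : Fin n → EuclideanSpace ℝ ι) {v : EuclideanSpace ℝ ι} (hv : ‖v‖ = 1) {b : ℝ} (hb : 0 < b)
    (hxv : ∑ i, (inner ℝ (x i) v) ^ 2 ≤ n * b ^ 2) :
    ENNReal.ofReal (b ^ (-(n / 8) : ℝ)) ≤ singularBound x := by
  have hn' : (0 : ℝ) < n := by exact_mod_cast hn
  -- The summand `1` in `singularBound` covers `b ≥ 1`; the integral is needed only for small `b`.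
  rcases le_or_gt 1 b with hb1 | hb1
  · refine le_trans ?_ le_self_add
    rw [ENNReal.ofReal_le_one]
    exact Real.rpow_le_one_of_one_le_of_nonpos hb1 (neg_nonpos.2 (by positivity))
  refine le_trans ?_ le_add_self
  set d := Fintype.card ι with hd'
  have hd0 : (0 : ℝ) < d := by exact_mod_cast Fintype.card_pos
  obtain ⟨F, hF⟩ : ∃ F, F = ∑ i, ‖x i‖ ^ 2 := ⟨_, rfl⟩
  have hF0 : 0 ≤ F := hF ▸ Finset.sum_nonneg fun i _ => sq_nonneg _
  -- The radius shrinks with the Frobenius norm so that no event `F ≲ nd` has to be excluded: the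
  -- condition on `r` becomes `s exp(-s) ≤ 1` at `s = F/(nd)`, and the price in `r^d` is only the
  -- factor `exp(-F/(2n))`, whose inverse has controlled moments.
  set r := b / 2 * Real.exp (-(F / (2 * n * d))) with hr
  have hr0 : 0 < r := by positivity
  have hr1 : r ≤ 1 / 2 := by
    have : Real.exp (-(F / (2 * n * d))) ≤ 1 := Real.exp_le_one_iff.2 (neg_nonpos.2 (by positivity))
    calc r ≤ b / 2 * 1 := mul_le_mul_of_nonneg_left this (by positivity)
      _ ≤ _ := by linarith
  have hxr : 4 * (F * r ^ 2) ≤ d * (n * b ^ 2) := by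
    have h1 : r ^ 2 = b ^ 2 / 4 * Real.exp (-(F / (n * d))) := by
      rw [hr, mul_pow, ← Real.exp_nat_mul, div_pow]
      congr 2
      · norm_num
      · push_cast; field_simp
    have h2 : F / (n * d) * Real.exp (-(F / (n * d))) ≤ 1 := by
      rw [Real.exp_neg, mul_inv_le_iff₀ (Real.exp_pos _), one_mul]
      linarith [Real.add_one_le_exp (F / (n * d))]
    calc 4 * (F * r ^ 2) = (n * d) * b ^ 2 * (F / (n * d) * Real.exp (-(F / (n * d)))) := by
          rw [h1]; field_simp
      _ ≤ (n * d) * b ^ 2 * 1 := by gcongr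
      _ = _ := by ring
  have hmain := mul_volume_ball_le_shellIntegral hn x hv hb hr1 hxv (hF ▸ hxr)
  rw [Measure.addHaar_ball _ _ hr0.le, finrank_euclideanSpace, ← hd', ← mul_assoc,
    ← ENNReal.ofReal_mul (by positivity)] at hmain
  set V := volume (Metric.ball (0 : EuclideanSpace ℝ ι) 1) with hV
  have hV0 : V ≠ 0 := (Metric.measure_ball_pos _ _ one_pos).ne'
  have hVt : V ≠ ∞ := measure_ball_lt_top.ne
  have hI : ENNReal.ofReal ((3 * b ^ 2) ^ (-(n / 8) : ℝ) * r ^ d) ≤ 2 * (V⁻¹ * shellIntegral x) := by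
    rw [mul_left_comm, mul_comm V⁻¹, ← div_eq_mul_inv,
      ENNReal.le_div_iff_mul_le (Or.inl hV0) (Or.inl hVt)]
    exact hmain
  have hreal : b ^ (-(n / 8) : ℝ) ≤ (3 ^ (n / 8 : ℝ) * 2 ^ d) * Real.exp (F / (2 * n))
      * ((3 * b ^ 2) ^ (-(n / 8) : ℝ) * r ^ d) := by
    have h1 : (3 * b ^ 2) ^ (-(n / 8) : ℝ)
        = ((3:ℝ) ^ (n / 8 : ℝ))⁻¹ * b ^ (-(n / 4) : ℝ) := by
      rw [Real.mul_rpow (by norm_num) (by positivity), Real.rpow_neg (by norm_num),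
        ← Real.rpow_natCast b 2, ← Real.rpow_mul hb.le]
      congr 2
      push_cast; ring
    have h2 : r ^ d = b ^ (d : ℝ) / 2 ^ d * (Real.exp (F / (2 * n)))⁻¹ := by
      rw [hr, mul_pow, div_pow, ← Real.exp_nat_mul, Real.rpow_natCast, ← Real.exp_neg]
      congr 2
      field_simp
    have h3 : (3 ^ (n / 8 : ℝ) * 2 ^ d) * Real.exp (F / (2 * n))
      * ((3 * b ^ 2) ^ (-(n / 8) : ℝ) * r ^ d) = b ^ (-(n / 4) + d : ℝ) := by
      rw [h1, h2, Real.rpow_add hb]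
      have : (3:ℝ) ^ (n / 8 : ℝ) ≠ 0 := by positivity
      have := (Real.exp_pos (F / (2 * n))).ne'
      field_simp
    rw [h3]
    -- Since `b < 1`, the hypothesis `d ≤ n/8` lets half of `b^(-n/4)` pay for the volume factor
    -- `b^d`.
    exact Real.rpow_le_rpow_of_exponent_ge hb hb1.le (by linarith)
  calc ENNReal.ofReal (b ^ (-(n / 8) : ℝ))
      ≤ ENNReal.ofReal (3 ^ (n / 8 : ℝ) * 2 ^ d) * ENNReal.ofReal (Real.exp (F / (2 * n)))
        * ENNReal.ofReal ((3 * b ^ 2) ^ (-(n / 8) : ℝ) * r ^ d) := by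
        rw [← ENNReal.ofReal_mul (by positivity), ← ENNReal.ofReal_mul (by positivity)]
        exact ENNReal.ofReal_le_ofReal hreal
    _ ≤ ENNReal.ofReal (3 ^ (n / 8 : ℝ) * 2 ^ d) * ENNReal.ofReal (Real.exp (F / (2 * n)))
        * (2 * (V⁻¹ * shellIntegral x)) := mul_le_mul_right hI _
    _ = _ := by
        rw [← hF, pow_succ, ← mul_assoc (3 ^ (n / 8 : ℝ) : ℝ), ENNReal.ofReal_mul (p := 3 ^ (n / 8 : ℝ) * 2 ^ d) (by positivity)]
        simp only [ENNReal.ofReal_ofNat]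
        ring

/-! ### Expectation of the singular value bound -/

theorem lintegral_exp_sq_div_le {n : ℕ} (hn : 4 ≤ n) :
    ∫⁻ t, ENNReal.ofReal (Real.exp (t ^ 2 / n)) ∂(gaussianReal 0 1) ≤ 2 ^ (4 / n : ℝ) := by
  have hn' : (4 : ℝ) ≤ n := by exact_mod_cast hn
  calc _ = ∫⁻ t, (ENNReal.ofReal (Real.exp (t ^ 2 / 4))) ^ (4 / n : ℝ) ∂(gaussianReal 0 1) := by
        refine lintegral_congr fun t => ?_
        rw [ENNReal.ofReal_rpow_of_pos (Real.exp_pos _), ← Real.exp_mul]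
        congr 2
        field_simp
    _ ≤ (∫⁻ t, ENNReal.ofReal (Real.exp (t ^ 2 / 4)) ∂(gaussianReal 0 1)) ^ (4 / n : ℝ) :=
        lintegral_rpow_le_rpow_lintegral (by fun_prop) (by positivity)
          ((div_le_one (by linarith)).2 hn')
    _ ≤ _ := ENNReal.rpow_le_rpow lintegral_exp_sq_div_four (by positivity)

theorem lintegral_exp_sum_norm_sq_div_le {n : ℕ} (hn : 4 ≤ n) :
    ∫⁻ Y : Fin n → ι → ℝ,
      ENNReal.ofReal (Real.exp ((∑ i, ‖(WithLp.toLp 2 (Y i) : EuclideanSpace ℝ ι)‖ ^ 2) / n))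
      ∂(Measure.pi fun _ => Measure.pi fun _ => gaussianReal 0 1) ≤ 16 ^ Fintype.card ι := by
  have hn' : (0 : ℝ) < n := by exact_mod_cast (by omega : 0 < n)
  have h1 : ∀ Y : Fin n → ι → ℝ,
      ENNReal.ofReal (Real.exp ((∑ i, ‖(WithLp.toLp 2 (Y i) : EuclideanSpace ℝ ι)‖ ^ 2) / n))
      = ∏ i, ∏ j, ENNReal.ofReal (Real.exp (Y i j ^ 2 / n)) := by
    intro Y
    rw [Finset.sum_div, Real.exp_sum, ENNReal.ofReal_prod_of_nonneg fun i _ => (Real.exp_pos _).le]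
    refine Finset.prod_congr rfl fun i _ => ?_
    rw [EuclideanSpace.real_norm_sq_eq, Finset.sum_div, Real.exp_sum,
      ENNReal.ofReal_prod_of_nonneg fun i _ => (Real.exp_pos _).le]
  simp_rw [h1]
  rw [lintegral_pi_prod (fun _ : Fin n => Measure.pi fun _ : ι => gaussianReal 0 1)
    (fun _ y => ∏ j, ENNReal.ofReal (Real.exp (y j ^ 2 / n))) (fun _ => by fun_prop)]
  simp_rw [lintegral_pi_prod (fun _ : ι => gaussianReal 0 1)
    (fun _ t => ENNReal.ofReal (Real.exp (t ^ 2 / n))) (fun _ => by fun_prop)]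
  refine (Finset.prod_le_prod' fun i _ => Finset.prod_le_prod' fun j _ =>
    lintegral_exp_sq_div_le hn).trans_eq ?_
  simp only [Finset.prod_const, Finset.card_univ, Fintype.card_fin]
  rw [← pow_mul, mul_comm, pow_mul, ← ENNReal.rpow_mul_natCast, div_mul_cancel₀ _ hn'.ne']
  norm_num

/-- The moment of order `-1/2` of a standard Gaussian variable. -/
noncomputable def negHalfMoment : ℝ≥0∞ := ∫⁻ x : ℝ, ‖x‖ₑ ^ (-(1/2) : ℝ) ∂(gaussianReal 0 1)

theorem lintegral_prod_enorm_rpow_le (n : ℕ) {u : EuclideanSpace ℝ ι} (hu : 1 / 2 ≤ ‖u‖) :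
    ∫⁻ Y : Fin n → ι → ℝ,
      ∏ i, ‖inner ℝ (WithLp.toLp 2 (Y i) : EuclideanSpace ℝ ι) u‖ₑ ^ (-(1/2) : ℝ)
      ∂(Measure.pi fun _ => Measure.pi fun _ => gaussianReal 0 1) ≤ (2 * negHalfMoment) ^ n := by
  have h1 : ∀ y : ι → ℝ, inner ℝ (WithLp.toLp 2 y : EuclideanSpace ℝ ι) u = ∑ j, y j * u j := by
    intro y
    simp [PiLp.inner_apply, mul_comm]
  simp_rw [h1]
  rw [lintegral_pi_prod (fun _ : Fin n => Measure.pi fun _ : ι => gaussianReal 0 1)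
    (fun _ y => ‖∑ j, y j * u j‖ₑ ^ (-(1/2) : ℝ)) (fun _ => by fun_prop)]
  simp_rw [lintegral_enorm_sum_mul_rpow]
  rw [Finset.prod_const, Finset.card_univ, Fintype.card_fin]
  gcongr ?_ ^ n
  refine mul_le_mul_left ?_ _
  have hu0 : 0 < ‖u‖ := by linarith
  rw [← ofReal_norm, ENNReal.ofReal_rpow_of_pos hu0]
  refine (ENNReal.ofReal_le_ofReal (q := 2) ?_).trans_eq (by simp)
  calc ‖u‖ ^ (-(1/2) : ℝ) ≤ (1/2 : ℝ) ^ (-(1/2) : ℝ) :=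
        Real.rpow_le_rpow_of_nonpos (by norm_num) hu (by norm_num)
    _ ≤ (1/2 : ℝ) ^ (-1 : ℝ) :=
        Real.rpow_le_rpow_of_exponent_ge (by norm_num) (by norm_num) (by norm_num)
    _ = 2 := by rw [Real.rpow_neg_one]; norm_num

theorem volume_shell_le [Nonempty ι] :
    volume (shell ι) ≤ 2 ^ Fintype.card ι * volume (Metric.ball (0 : EuclideanSpace ℝ ι) 1) := by
  refine (measure_mono Set.inter_subset_left).trans ?_
  rw [Measure.addHaar_ball _ _ (by norm_num), finrank_euclideanSpace,
    ENNReal.ofReal_pow (by norm_num)]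
  gcongr
  rw [show (2 : ℝ≥0∞) = ENNReal.ofReal 2 by simp]
  exact ENNReal.ofReal_le_ofReal (by norm_num)

theorem measurable_shellIntegral {n : ℕ} :
    Measurable (shellIntegral : (Fin n → EuclideanSpace ℝ ι) → ℝ≥0∞) := by
  unfold shellIntegral
  refine Measurable.lintegral_prod_right' (f := fun q : (Fin n → EuclideanSpace ℝ ι) ×
    EuclideanSpace ℝ ι => ∏ i, ‖inner ℝ (q.1 i) q.2‖ₑ ^ (-(1/4) : ℝ)) ?_
  fun_prop

theorem measurable_singularBound {n : ℕ} :
    Measurable (singularBound : (Fin n → EuclideanSpace ℝ ι) → ℝ≥0∞) := by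
  unfold singularBound
  have := measurable_shellIntegral (ι := ι) (n := n)
  fun_prop

/-- The product is decoupled by `a b ≤ a² + b²`. Squaring turns the exponent `-1/4` into `-1/2`,
still above `-1` and hence integrable against a Gaussian, and `F/(2n)` into `F/n`. On the shell `‖u‖
≥ 1/2` keeps the negative moments bounded. -/
theorem lintegral_exp_mul_shellIntegral_le {n : ℕ} (hn : 4 ≤ n) :
    ∫⁻ Y : Fin n → ι → ℝ, ENNReal.ofReal (Real.exp
        ((∑ i, ‖(WithLp.toLp 2 (Y i) : EuclideanSpace ℝ ι)‖ ^ 2) / (2 * n)))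
        * shellIntegral (fun i => (WithLp.toLp 2 (Y i) : EuclideanSpace ℝ ι))
      ∂(Measure.pi fun _ => Measure.pi fun _ => gaussianReal 0 1)
    ≤ (16 ^ Fintype.card ι + (2 * negHalfMoment) ^ n) * volume (shell ι) := by
  unfold shellIntegral
  have hmul : ∀ Y : Fin n → ι → ℝ, ENNReal.ofReal (Real.exp
        ((∑ i, ‖(WithLp.toLp 2 (Y i) : EuclideanSpace ℝ ι)‖ ^ 2) / (2 * n)))
        * ∫⁻ u in shell ι, ∏ i, ‖inner ℝ (WithLp.toLp 2 (Y i)) u‖ₑ ^ (-(1/4) : ℝ)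
      = ∫⁻ u in shell ι, ENNReal.ofReal (Real.exp
        ((∑ i, ‖(WithLp.toLp 2 (Y i) : EuclideanSpace ℝ ι)‖ ^ 2) / (2 * n)))
        * ∏ i, ‖inner ℝ (WithLp.toLp 2 (Y i)) u‖ₑ ^ (-(1/4) : ℝ) := fun Y => by
    rw [lintegral_const_mul _ (by fun_prop)]
  simp_rw [hmul]
  rw [lintegral_lintegral_swap (by fun_prop), ← setLIntegral_const]
  refine setLIntegral_mono' measurableSet_shell fun u hu => ?_
  refine le_trans ?_ (add_le_add (lintegral_exp_sum_norm_sq_div_le hn)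
    (lintegral_prod_enorm_rpow_le n hu.2))
  rw [← lintegral_add_left (by fun_prop)]
  refine lintegral_mono fun Y => ?_
  have hsq : ∀ a b : ℝ≥0∞, a * b ≤ a ^ 2 + b ^ 2 := by
    intro a b
    rcases le_total a b with h | h
    · exact (mul_le_mul_left h b).trans (by rw [← sq]; exact le_add_self)
    · exact (mul_le_mul_right h a).trans (by rw [← sq]; exact le_self_add)
  refine (hsq _ _).trans_eq ?_
  congr 1
  · rw [← ENNReal.ofReal_pow (Real.exp_pos _).le, ← Real.exp_nat_mul]
    congr 2
    push_cast
    field_simp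
  · rw [← Finset.prod_pow]
    refine Finset.prod_congr rfl fun i _ => ?_
    rw [← ENNReal.rpow_mul_natCast]
    norm_num

/-- The exponential growth rate of the expectation of `singularBound`. -/
noncomputable def growthRate : ℝ≥0∞ := 60 * (16 + 2 * negHalfMoment)

theorem growthRate_ne_top : growthRate ≠ ∞ := by
  have := lintegral_enorm_rpow_gaussianReal_ne_top
  exact ENNReal.mul_ne_top (by simp) (ENNReal.add_ne_top.2 ⟨by simp, ENNReal.mul_ne_top (by simp) this⟩)

theorem lintegral_singularBound_le [Nonempty ι] {n : ℕ} (hn : 4 ≤ n)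
    (hd : (Fintype.card ι : ℝ) ≤ n / 8) :
    ∫⁻ Y : Fin n → ι → ℝ, singularBound (fun i => (WithLp.toLp 2 (Y i) : EuclideanSpace ℝ ι))
      ∂(Measure.pi fun _ => Measure.pi fun _ => gaussianReal 0 1) ≤ growthRate ^ n := by
  have hn' : (0 : ℝ) < n := by exact_mod_cast (by omega : 0 < n)
  have hdn : Fintype.card ι ≤ n := by
    have : (Fintype.card ι : ℝ) ≤ n := hd.trans (by linarith)
    exact_mod_cast this
  unfold singularBound
  have hms : Measurable fun Y : Fin n → ι → ℝ =>
      shellIntegral (fun i => (WithLp.toLp 2 (Y i) : EuclideanSpace ℝ ι)) :=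
    measurable_shellIntegral.comp (by fun_prop)
  set d := Fintype.card ι with hd'
  set V := volume (Metric.ball (0 : EuclideanSpace ℝ ι) 1) with hV
  have hV0 : V ≠ 0 := (Metric.measure_ball_pos _ _ one_pos).ne'
  have hVt : V ≠ ∞ := measure_ball_lt_top.ne
  set c : ℝ≥0∞ := 16 + 2 * negHalfMoment with hc
  have hc1 : (1 : ℝ≥0∞) ≤ c := le_trans (by norm_num) le_self_add
  have hexp : ENNReal.ofReal (3 ^ (n / 8 : ℝ) * 2 ^ (d + 1)) ≤ 2 * 6 ^ n := by
    rw [show (2 * 6 ^ n : ℝ≥0∞) = ENNReal.ofReal (2 * 6 ^ n) by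
      rw [ENNReal.ofReal_mul (by norm_num), ENNReal.ofReal_pow (by norm_num)]; simp]
    refine ENNReal.ofReal_le_ofReal ?_
    calc (3 : ℝ) ^ (n / 8 : ℝ) * 2 ^ (d + 1) ≤ 3 ^ (n : ℝ) * 2 ^ (n + 1) := by
          gcongr
          · norm_num
          · linarith
          · norm_num
      _ = 2 * (3 * 2) ^ n := by rw [Real.rpow_natCast, mul_pow, pow_succ]; ring
      _ = _ := by norm_num
  have hmain : (16 ^ d + (2 * negHalfMoment) ^ n) * volume (shell ι) ≤ 2 * c ^ n * (2 ^ n * V) := by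
    refine mul_le_mul' ?_ ?_
    · rw [two_mul (c ^ n)]
      refine add_le_add ?_ ?_
      · exact (pow_le_pow_right₀ (by norm_num) hdn).trans (pow_le_pow_left' le_self_add n)
      · exact pow_le_pow_left' le_add_self n
    · exact volume_shell_le.trans (mul_le_mul_left (pow_le_pow_right₀ (by norm_num) hdn) _)
  calc _ = 1 + ENNReal.ofReal (3 ^ (n / 8 : ℝ) * 2 ^ (d + 1)) * (V⁻¹ *
        ∫⁻ Y : Fin n → ι → ℝ, ENNReal.ofReal (Real.exp
        ((∑ i, ‖(WithLp.toLp 2 (Y i) : EuclideanSpace ℝ ι)‖ ^ 2) / (2 * n)))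
        * shellIntegral (fun i => (WithLp.toLp 2 (Y i) : EuclideanSpace ℝ ι))
      ∂(Measure.pi fun _ => Measure.pi fun _ => gaussianReal 0 1)) := by
        rw [lintegral_add_left measurable_const, lintegral_const_mul _ (by fun_prop),
          ← lintegral_const_mul V⁻¹ (by fun_prop)]
        simp only [lintegral_const, measure_univ, mul_one]
        congr 2
        refine lintegral_congr fun Y => ?_
        ring
    _ ≤ 1 + (2 * 6 ^ n) * (V⁻¹ * (2 * c ^ n * (2 ^ n * V))) := by
        gcongr
        exact (lintegral_exp_mul_shellIntegral_le hn).trans hmain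
    _ = 1 + 4 * (12 * c) ^ n := by
        rw [show V⁻¹ * (2 * c ^ n * (2 ^ n * V)) = 2 * c ^ n * 2 ^ n * (V * V⁻¹) by ring,
          ENNReal.mul_inv_cancel hV0 hVt, mul_pow, show (12 : ℝ≥0∞) = 6 * 2 by norm_num, mul_pow]
        ring
    _ ≤ 5 ^ n * (12 * c) ^ n := by
        have h1 : (1 : ℝ≥0∞) ≤ (12 * c) ^ n :=
          one_le_pow₀ (hc1.trans (le_mul_of_one_le_left' (by norm_num)))
        calc 1 + 4 * (12 * c) ^ n ≤ (12 * c) ^ n + 4 * (12 * c) ^ n := by gcongr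
          _ = 5 ^ 1 * (12 * c) ^ n := by ring
          _ ≤ _ := by
            gcongr
            · norm_num
            · omega
    _ = growthRate ^ n := by
        rw [← mul_pow, ← mul_assoc]
        unfold growthRate
        norm_num [hc]

/-! ### Error bound on a fixed support -/

/-- The rows of the submatrix of `X` with columns in `S`. -/
def subRows {n p : ℕ} (X : Fin n → Fin p → ℝ) (S : Finset (Fin p)) (i : Fin n) :
    EuclideanSpace ℝ S := WithLp.toLp 2 fun j => X i j

/-- The span of the columns of `X` with index in `S`. -/
def colSpan {n p : ℕ} (X : Fin n → Fin p → ℝ) (S : Finset (Fin p)) :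
    Submodule ℝ (EuclideanSpace ℝ (Fin n)) :=
  Submodule.span ℝ ((fun j => (WithLp.toLp 2 fun i => X i j : EuclideanSpace ℝ (Fin n))) '' S)

/-- The norm of the projection of the noise on the span of the columns in `S`. -/
noncomputable def projNorm {n p : ℕ} (X : Fin n → Fin p → ℝ) (S : Finset (Fin p))
    (z : Fin n → ℝ) : ℝ := ‖(colSpan X S).starProjection (WithLp.toLp 2 z)‖

theorem finrank_colSpan_le {n p : ℕ} (X : Fin n → Fin p → ℝ) (S : Finset (Fin p)) :
    Module.finrank ℝ (colSpan X S) ≤ S.card := by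
  classical
  unfold colSpan
  rw [← Finset.coe_image]
  exact (finrank_span_finset_le_card _).trans Finset.card_image_le

theorem measurable_projNorm {n p : ℕ} (X : Fin n → Fin p → ℝ) (S : Finset (Fin p)) :
    Measurable (projNorm X S) := by
  unfold projNorm
  fun_prop

theorem measurable_singularBound_subRows {n p : ℕ} (S : Finset (Fin p)) :
    Measurable fun X : Fin n → Fin p → ℝ => singularBound (subRows X S) := by
  refine measurable_singularBound.comp ?_
  unfold subRows
  fun_prop

theorem measurePreserving_restrict_designLaw (n p : ℕ) (S : Finset (Fin p)) :
    MeasurePreserving (fun (X : Fin n → Fin p → ℝ) i => S.restrict (X i)) (designLaw n p)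
      (Measure.pi fun _ => Measure.pi fun _ => gaussianReal 0 1) := by
  refine measurePreserving_pi (fun _ : Fin n => Measure.pi fun _ : Fin p => gaussianReal 0 1)
    (fun _ : Fin n => Measure.pi fun _ : S => gaussianReal 0 1) fun i => ⟨by fun_prop, ?_⟩
  rw [← Measure.infinitePi_eq_pi, Measure.infinitePi_map_restrict]

theorem lintegral_designLaw_singularBound_le {n p : ℕ} (hn : 4 ≤ n) {S : Finset (Fin p)}
    (hS : S.Nonempty) (hd : (S.card : ℝ) ≤ n / 8) :
    ∫⁻ X, singularBound (subRows X S) ∂(designLaw n p) ≤ growthRate ^ n := by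
  have : Nonempty S := hS.to_subtype
  have h1 := lintegral_singularBound_le (ι := S) hn (by simpa using hd)
  rwa [← (measurePreserving_restrict_designLaw n p S).lintegral_comp] at h1
  exact measurable_singularBound.comp (by fun_prop)

theorem enorm_rpow_le_mul_singularBound {n p : ℕ} (hn : 0 < n) {S : Finset (Fin p)}
    (hS : S.Nonempty) (hd : (S.card : ℝ) ≤ n / 8) (X : Fin n → Fin p → ℝ) (z : Fin n → ℝ)
    {h : EuclideanSpace ℝ (Fin p)} (hh : ∀ j ∉ S, h j = 0)
    (hres : ‖(WithLp.toLp 2 (z - Matrix.of X *ᵥ h.ofLp) : EuclideanSpace ℝ (Fin n))‖ ^ 2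
      ≤ ‖(WithLp.toLp 2 z : EuclideanSpace ℝ (Fin n))‖ ^ 2)
    {σ m : ℝ} (hσ : 0 < σ) (hm : 0 < m) :
    ‖h‖ₑ ^ m ≤ ENNReal.ofReal (((2 * projNorm X S z + σ) / √n) ^ m)
      * singularBound (subRows X S) ^ (8 * m / n) := by
  have hn' : (0 : ℝ) < n := by exact_mod_cast hn
  have : Nonempty S := hS.to_subtype
  rcases eq_or_ne h 0 with rfl | h0
  · simp [hm]
  have hpos : 0 < ‖h‖ := norm_pos_iff.2 h0
  set W := projNorm X S z with hW
  have hW0 : 0 ≤ W := norm_nonneg _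
  set Xh : EuclideanSpace ℝ (Fin n) := WithLp.toLp 2 (Matrix.of X *ᵥ h.ofLp) with hXh
  have hXi : ∀ i, Xh i = ∑ j ∈ S, X i j * h j := by
    intro i
    simp only [hXh, Matrix.mulVec, dotProduct, Matrix.of_apply]
    refine (Finset.sum_subset (Finset.subset_univ S) fun j _ hj => ?_).symm
    rw [hh j hj, mul_zero]
  have hmem : Xh ∈ colSpan X S := by
    have : Xh = ∑ j ∈ S, h j • (WithLp.toLp 2 fun i => X i j : EuclideanSpace ℝ (Fin n)) := by
      ext i
      rw [hXi]
      simp [mul_comm]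
    rw [this]
    exact Submodule.sum_mem _ fun j hj => Submodule.smul_mem _ _
      (Submodule.subset_span ⟨j, hj, rfl⟩)
  have hXW : ‖Xh‖ ≤ 2 * W := norm_le_two_mul_norm_starProjection _ hmem hres
  set g : EuclideanSpace ℝ S := WithLp.toLp 2 fun j : S => h j with hg
  have hgn : ‖g‖ = ‖h‖ := by
    rw [EuclideanSpace.norm_eq, EuclideanSpace.norm_eq]
    congr 1
    have hsub : ∑ j ∈ S, ‖h j‖ ^ 2 = ∑ j, ‖h j‖ ^ 2 :=
      Finset.sum_subset (Finset.subset_univ S) fun j _ hj => by simp [hh j hj]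
    rw [← hsub, ← Finset.sum_coe_sort S]
  have hinner : ∀ i, inner ℝ (subRows X S i) g = Xh i := by
    intro i
    rw [hXi, PiLp.inner_apply, ← Finset.sum_coe_sort S fun j => X i j * h j]
    refine Finset.sum_congr rfl fun j _ => ?_
    simp [subRows, hg, mul_comm]
  -- The largest value of `‖X h‖ / (√n ‖h‖)` allowed by the basic inequality; the extra `σ` keeps
  -- `b` positive when the projected noise vanishes.
  set b := (2 * W + σ) / √n / ‖h‖ with hb
  have hsn : 0 < √(n : ℝ) := Real.sqrt_pos.2 hn'
  have hb0 : 0 < b := by positivity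
  have hbound := ofReal_rpow_le_singularBound hn (by simpa using hd) (subRows X S)
    (v := ‖h‖⁻¹ • g) (by rw [norm_smul, hgn, norm_inv, norm_norm, inv_mul_cancel₀ hpos.ne']) hb0 ?_
  · have h2 : ENNReal.ofReal (b ^ (-m)) ≤ singularBound (subRows X S) ^ (8 * m / n) := by
      refine le_trans ?_ (ENNReal.rpow_le_rpow hbound (by positivity))
      rw [ENNReal.ofReal_rpow_of_pos (by positivity), ← Real.rpow_mul hb0.le]
      refine ENNReal.ofReal_le_ofReal (le_of_eq ?_)
      congr 1
      field_simp
    refine le_trans (le_of_eq ?_) (mul_le_mul_right h2 _)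
    rw [← ENNReal.ofReal_mul (by positivity), ← ofReal_norm, ENNReal.ofReal_rpow_of_pos hpos,
      Real.rpow_neg hb0.le, ← Real.inv_rpow hb0.le, ← Real.mul_rpow (by positivity) (by positivity)]
    congr 2
    rw [hb]
    have : 2 * W + σ ≠ 0 := by positivity
    field_simp
  · simp_rw [inner_smul_right, hinner, mul_pow]
    rw [← Finset.mul_sum, ← EuclideanSpace.real_norm_sq_eq, hb, div_pow, div_pow,
      Real.sq_sqrt hn'.le, inv_pow, inv_mul_eq_div]
    have h3 : (n : ℝ) * ((2 * W + σ) ^ 2 / n / ‖h‖ ^ 2) = (2 * W + σ) ^ 2 / ‖h‖ ^ 2 := by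
      field_simp
    rw [h3]
    gcongr
    linarith

/-- The constant in the moment bound for the projected noise. -/
noncomputable def momentConst (m : ℝ) : ℝ := (5 * m) ^ m * Real.exp 1

/-- With `y` the excess of `T = W²/(4σ²)` over `L`, one has `2W + σ ≤ 5σ√L (1 + y)` and `(1 + y)^m ≤
m^m exp(1 + y)`. The final factor has bounded expectation even after the exponentials are summed
over all supports. -/
theorem rpow_le_momentConst_mul {m L W σ : ℝ} (hm : 1 ≤ m) (hL : 1 ≤ L) (hW : 0 ≤ W) (hσ : 0 < σ) :
    (2 * W + σ) ^ m ≤ momentConst m * (σ * √L) ^ m *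
      (1 + Real.exp (-L) * Real.exp (W ^ 2 / (4 * σ ^ 2))) := by
  have hm0 : 0 < m := by linarith
  set T := W ^ 2 / (4 * σ ^ 2) with hT
  set y := max (T - L) 0 with hy
  have hy0 : 0 ≤ y := le_max_right _ _
  have hTy : T ≤ L + y := by linarith [le_max_left (T - L) 0]
  have hs1 : 1 ≤ √L := Real.one_le_sqrt.2 hL
  have hsq : √L ^ 2 = L := Real.sq_sqrt (by linarith)
  have hW2 : W ^ 2 = 4 * σ ^ 2 * T := by rw [hT]; field_simp
  have hWle : W ≤ 2 * σ * √L * (1 + y) := by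
    refine abs_le_of_sq_le_sq' ?_ (by positivity) |>.2
    calc W ^ 2 = 4 * σ ^ 2 * T := hW2
      _ ≤ 4 * σ ^ 2 * (L * (1 + y) ^ 2) := by
        gcongr
        nlinarith [mul_nonneg hy0 hy0, mul_nonneg (sub_nonneg.2 hL) hy0]
      _ = _ := by rw [mul_pow, mul_pow, hsq]; ring
  have h1 : 2 * W + σ ≤ 5 * (σ * √L) * (1 + y) := by
    have : σ ≤ σ * √L * (1 + y) := by
      rw [mul_assoc]
      refine le_mul_of_one_le_right hσ.le ?_
      nlinarith
    linarith
  have h2 : 1 + y ≤ m * Real.exp ((1 + y) / m) := by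
    have := Real.add_one_le_exp ((1 + y) / m)
    calc 1 + y = m * ((1 + y) / m) := by field_simp
      _ ≤ _ := by gcongr; linarith
  have h3 : Real.exp y ≤ 1 + Real.exp (-L) * Real.exp T := by
    rw [← Real.exp_add]
    rcases max_cases (T - L) 0 with ⟨h, -⟩ | ⟨h, -⟩
    · rw [hy, h, neg_add_eq_sub]; linarith [Real.exp_pos (T - L)]
    · rw [hy, h, Real.exp_zero]; linarith [Real.exp_pos (-L + T)]
  calc (2 * W + σ) ^ m ≤ (5 * (σ * √L) * (m * Real.exp ((1 + y) / m))) ^ m := by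
        gcongr
        exact h1.trans (by gcongr)
    _ = momentConst m * (σ * √L) ^ m * Real.exp y := by
        rw [show 5 * (σ * √L) * (m * Real.exp ((1 + y) / m))
          = (5 * m) * (σ * √L) * Real.exp ((1 + y) / m) by ring,
          Real.mul_rpow (by positivity) (by positivity), Real.mul_rpow (by positivity) (by positivity),
          ← Real.exp_mul, div_mul_cancel₀ _ hm0.ne', Real.exp_add, momentConst]
        ring
    _ ≤ _ := by
        have : 0 ≤ momentConst m := by unfold momentConst; positivity
        gcongr

/-- The union of the two supports is padded to size exactly `2k`, so that all supports range over
one `powersetCard`. -/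
theorem exists_superset_of_mem_sparseVectors {p k : ℕ} (hp : 2 * k ≤ p)
    {β γ : EuclideanSpace ℝ (Fin p)} (hβ : β ∈ sparseVectors p k) (hγ : γ ∈ sparseVectors p k) :
    ∃ S ∈ Finset.powersetCard (2 * k) (Finset.univ : Finset (Fin p)),
      ∀ j ∉ S, (γ - β) j = 0 := by
  classical
  have hcard : ∀ δ ∈ sparseVectors p k, (Finset.univ.filter fun i => δ i ≠ 0).card ≤ k := by
    intro δ hδ
    have h : {i : Fin p | δ i ≠ 0}.ncard ≤ k := hδ
    rwa [Set.ncard_eq_toFinset_card', Set.toFinset_ofPred] at h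
  obtain ⟨S, hS, hSc⟩ := Finset.exists_superset_card_eq (n := 2 * k)
    (s := (Finset.univ.filter fun i => β i ≠ 0) ∪ (Finset.univ.filter fun i => γ i ≠ 0))
    ((Finset.card_union_le _ _).trans (by linarith [hcard β hβ, hcard γ hγ])) (by simpa using hp)
  refine ⟨S, Finset.mem_powersetCard.2 ⟨Finset.subset_univ _, hSc⟩, fun j hj => ?_⟩
  have h1 : j ∉ (Finset.univ.filter fun i => β i ≠ 0) ∪ (Finset.univ.filter fun i => γ i ≠ 0) :=
    fun h => hj (hS h)
  simp only [Finset.mem_union, Finset.mem_filter, Finset.mem_univ, true_and, not_or, not_not] at h1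
  simp [h1.1, h1.2]

theorem residual_le {n p k : ℕ}
    {est : (Fin n → Fin p → ℝ) × (Fin n → ℝ) → EuclideanSpace ℝ (Fin p)}
    (hest : IsSparseLeastSquares k est) {β : EuclideanSpace ℝ (Fin p)}
    (hβ : β ∈ sparseVectors p k) (X : Fin n → Fin p → ℝ) (z : Fin n → ℝ) :
    ‖(WithLp.toLp 2 (z - Matrix.of X *ᵥ (est (X, Matrix.of X *ᵥ β.ofLp + z) - β).ofLp) :
      EuclideanSpace ℝ (Fin n))‖ ^ 2 ≤ ‖(WithLp.toLp 2 z : EuclideanSpace ℝ (Fin n))‖ ^ 2 := by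
  have h := hest.isMin X (Matrix.of X *ᵥ β.ofLp + z) hβ
  simp only [Set.mem_ofPred_eq, residualSq, add_sub_cancel_left] at h
  have he : z - Matrix.of X *ᵥ (est (X, Matrix.of X *ᵥ β.ofLp + z) - β).ofLp
      = Matrix.of X *ᵥ β.ofLp + z - Matrix.of X *ᵥ (est (X, Matrix.of X *ᵥ β.ofLp + z)).ofLp := by
    rw [WithLp.ofLp_sub, Matrix.mulVec_sub]
    abel
  rwa [he]

/-! ### Summation over supports and moment bound -/

/-- The total of `singularBound` over the column subsets of size `d`. -/
noncomputable def totalBound {n p : ℕ} (d : ℕ) (X : Fin n → Fin p → ℝ) : ℝ≥0∞ :=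
  ∑ S ∈ Finset.powersetCard d Finset.univ, singularBound (subRows X S)

/-- The total exponential moment weight of the projected noise. -/
noncomputable def noiseWeight {n p : ℕ} (d : ℕ) (L σ : ℝ) (X : Fin n → Fin p → ℝ)
    (z : Fin n → ℝ) : ℝ≥0∞ :=
  1 + ENNReal.ofReal (Real.exp (-L)) * ∑ S ∈ Finset.powersetCard d Finset.univ,
    ENNReal.ofReal (Real.exp (projNorm X S z ^ 2 / (4 * σ ^ 2)))

theorem lintegral_noiseWeight_le {n p d : ℕ} {L σ : ℝ} (hσ : 0 < σ)
    (hL : (p.choose d : ℝ) * 2 ^ d ≤ Real.exp L) (X : Fin n → Fin p → ℝ) :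
    ∫⁻ z, noiseWeight d L σ X z ∂(noiseLaw n σ) ≤ 2 := by
  have hm : ∀ S : Finset (Fin p), Measurable fun z =>
      ENNReal.ofReal (Real.exp (projNorm X S z ^ 2 / (4 * σ ^ 2))) := fun S => by
    have := measurable_projNorm X S
    fun_prop
  have : IsProbabilityMeasure (noiseLaw n σ) := by unfold noiseLaw; infer_instance
  unfold noiseWeight
  rw [lintegral_add_left measurable_const,
    lintegral_const_mul _ (Finset.measurable_sum _ fun S _ => hm S),
    lintegral_finsetSum _ fun S _ => hm S]
  have h1 : ∑ S ∈ Finset.powersetCard d (Finset.univ : Finset (Fin p)),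
      ∫⁻ z, ENNReal.ofReal (Real.exp (projNorm X S z ^ 2 / (4 * σ ^ 2))) ∂(noiseLaw n σ)
      ≤ ENNReal.ofReal (Real.exp L) := by
    calc _ ≤ ∑ S ∈ Finset.powersetCard d (Finset.univ : Finset (Fin p)), (2 : ℝ≥0∞) ^ d := by
          refine Finset.sum_le_sum fun S hS => ?_
          refine (lintegral_exp_norm_starProjection_sq_le (colSpan X S) hσ).trans ?_
          refine pow_le_pow_right₀ (by norm_num) ?_
          exact (finrank_colSpan_le X S).trans_eq (Finset.mem_powersetCard.1 hS).2
      _ = ENNReal.ofReal ((p.choose d : ℝ) * 2 ^ d) := by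
          rw [Finset.sum_const, Finset.card_powersetCard, Finset.card_univ, Fintype.card_fin,
            ENNReal.ofReal_mul (by positivity), ENNReal.ofReal_natCast,
            ENNReal.ofReal_pow (by norm_num), nsmul_eq_mul]
          simp
      _ ≤ _ := ENNReal.ofReal_le_ofReal hL
  calc _ ≤ 1 + ENNReal.ofReal (Real.exp (-L)) * ENNReal.ofReal (Real.exp L) := by
        refine add_le_add (by simp) (mul_le_mul_right h1 _)
    _ = 2 := by
        rw [← ENNReal.ofReal_mul (Real.exp_pos _).le, ← Real.exp_add, neg_add_cancel]
        norm_num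

/-- Jensen applies since `8m/n ≤ 1`. As `choose p d ≤ exp L ≤ 3^n`, the number of supports only
changes the base of an `n`-th power, and the exponent `8m/n` removes the dependence on `n`. -/
theorem lintegral_totalBound_rpow_le {n p d : ℕ} {L m : ℝ} (hn : 4 ≤ n) (hd0 : 0 < d)
    (hd : (d : ℝ) ≤ n / 8) (hL : (p.choose d : ℝ) * 2 ^ d ≤ Real.exp L) (hLn : L ≤ n)
    (hm : 0 ≤ m) (hmn : 8 * m ≤ n) :
    ∫⁻ X, totalBound d X ^ (8 * m / n) ∂(designLaw n p)
      ≤ (3 * growthRate) ^ (8 * m) := by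
  have hn' : (0 : ℝ) < n := by exact_mod_cast (by omega : 0 < n)
  have : IsProbabilityMeasure (designLaw n p) := by unfold designLaw; infer_instance
  have hmeas : Measurable (totalBound d : (Fin n → Fin p → ℝ) → ℝ≥0∞) :=
    Finset.measurable_sum _ fun S _ => measurable_singularBound_subRows S
  refine (lintegral_rpow_le_rpow_lintegral hmeas.aemeasurable (by positivity)
    ((div_le_one hn').2 hmn)).trans ?_
  have h1 : ∫⁻ X, totalBound d X ∂(designLaw n p) ≤ (3 * growthRate) ^ n := by
    unfold totalBound
    rw [lintegral_finsetSum _ fun S _ => measurable_singularBound_subRows S]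
    calc _ ≤ ∑ S ∈ Finset.powersetCard d (Finset.univ : Finset (Fin p)), growthRate ^ n := by
          refine Finset.sum_le_sum fun S hS => ?_
          have hc := (Finset.mem_powersetCard.1 hS).2
          refine lintegral_designLaw_singularBound_le hn ?_ (by rwa [hc])
          rw [← Finset.card_pos, hc]
          exact hd0
      _ = (p.choose d : ℝ≥0∞) * growthRate ^ n := by
          rw [Finset.sum_const, Finset.card_powersetCard, Finset.card_univ, Fintype.card_fin,
            nsmul_eq_mul]
      _ ≤ 3 ^ n * growthRate ^ n := by
          gcongr
          have h2 : (p.choose d : ℝ) ≤ 3 ^ n := by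
            calc (p.choose d : ℝ) ≤ (p.choose d : ℝ) * 2 ^ d :=
                  le_mul_of_one_le_right (by positivity) (one_le_pow₀ (by norm_num))
              _ ≤ Real.exp L := hL
              _ ≤ Real.exp n := Real.exp_le_exp.2 hLn
              _ = Real.exp 1 ^ n := by rw [← Real.exp_nat_mul, mul_one]
              _ ≤ 3 ^ n := by gcongr; linarith [Real.exp_one_lt_d9]
          exact_mod_cast h2
      _ = _ := (mul_pow _ _ _).symm
  refine (ENNReal.rpow_le_rpow h1 (by positivity)).trans_eq ?_
  rw [← ENNReal.rpow_natCast, ← ENNReal.rpow_mul, mul_div_cancel₀ _ hn'.ne']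

/-- Moment bound for a fixed sample size. -/
theorem errorMoment_le {n p k : ℕ} {L σ m : ℝ} (hn : 4 ≤ n) (hk : 0 < k) (hp : 2 * k ≤ p)
    (hd : ((2 * k : ℕ) : ℝ) ≤ n / 8) (hL : (p.choose (2 * k) : ℝ) * 2 ^ (2 * k) ≤ Real.exp L)
    (hL1 : 1 ≤ L) (hLn : L ≤ n) (hm : 1 ≤ m) (hmn : 8 * m ≤ n) (hσ : 0 < σ)
    {est : (Fin n → Fin p → ℝ) × (Fin n → ℝ) → EuclideanSpace ℝ (Fin p)}
    (hest : IsSparseLeastSquares k est) {β : EuclideanSpace ℝ (Fin p)}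
    (hβ : β ∈ sparseVectors p k) :
    errorMoment est σ m β ≤ ENNReal.ofReal (momentConst m * (σ * √L / √n) ^ m) * 2
      * (3 * growthRate) ^ (8 * m) := by
  have hn0 : 0 < n := by omega
  have hn' : (0 : ℝ) < n := by exact_mod_cast hn0
  have hc0 : 0 ≤ momentConst m := by unfold momentConst; positivity
  have hpt : ∀ X z, ‖est (X, Matrix.of X *ᵥ β.ofLp + z) - β‖ₑ ^ m
      ≤ ENNReal.ofReal (momentConst m * (σ * √L / √n) ^ m) * noiseWeight (2 * k) L σ X z
        * totalBound (2 * k) X ^ (8 * m / n) := by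
    intro X z
    obtain ⟨S, hS, hS0⟩ := exists_superset_of_mem_sparseVectors hp hβ
      (hest.mem_sparse X (Matrix.of X *ᵥ β.ofLp + z))
    have hc := (Finset.mem_powersetCard.1 hS).2
    refine (enorm_rpow_le_mul_singularBound hn0 (S := S) (by rw [← Finset.card_pos]; omega)
      (by rwa [hc]) X z hS0 (residual_le hest hβ X z) hσ (by linarith)).trans ?_
    refine mul_le_mul' ?_ (ENNReal.rpow_le_rpow ?_ (by positivity))
    · have hW0 : 0 ≤ projNorm X S z := norm_nonneg _
      have h1 : ((2 * projNorm X S z + σ) / √n) ^ m ≤ momentConst m * (σ * √L / √n) ^ m *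
          (1 + Real.exp (-L) * Real.exp (projNorm X S z ^ 2 / (4 * σ ^ 2))) := by
        rw [Real.div_rpow (by positivity) (by positivity),
          Real.div_rpow (by positivity) (by positivity), mul_div_assoc', div_mul_eq_mul_div]
        gcongr
        exact rpow_le_momentConst_mul hm hL1 hW0 hσ
      refine (ENNReal.ofReal_le_ofReal h1).trans ?_
      rw [ENNReal.ofReal_mul (by positivity)]
      refine mul_le_mul_right ?_ _
      rw [ENNReal.ofReal_add (by norm_num) (by positivity), ENNReal.ofReal_mul (by positivity),
        ENNReal.ofReal_one]
      unfold noiseWeight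
      gcongr
      exact Finset.single_le_sum (f := fun S =>
        ENNReal.ofReal (Real.exp (projNorm X S z ^ 2 / (4 * σ ^ 2)))) (fun _ _ => zero_le) hS
    · exact Finset.single_le_sum (f := fun S => singularBound (subRows X S))
        (fun _ _ => zero_le) hS
  have hmw : ∀ X : Fin n → Fin p → ℝ, Measurable (noiseWeight (2 * k) L σ X) := by
    intro X
    unfold noiseWeight
    refine (Measurable.const_mul (Finset.measurable_sum _ fun S _ => ?_) _).const_add _
    have := measurable_projNorm X S
    fun_prop
  have hmt : Measurable fun X : Fin n → Fin p → ℝ => totalBound (2 * k) X ^ (8 * m / n) :=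
    (Finset.measurable_sum _ fun S _ => measurable_singularBound_subRows S).pow_const _
  unfold errorMoment
  have : SFinite (noiseLaw n σ) := by unfold noiseLaw; infer_instance
  -- This half of Tonelli requires no joint measurability; the bound that follows is integrated in
  -- `z` for each fixed `X`.
  refine (lintegral_prod_le _).trans ?_
  calc _ ≤ ∫⁻ X, ∫⁻ z, ENNReal.ofReal (momentConst m * (σ * √L / √n) ^ m)
          * noiseWeight (2 * k) L σ X z * totalBound (2 * k) X ^ (8 * m / n) ∂(noiseLaw n σ)
          ∂(designLaw n p) := lintegral_mono fun X => lintegral_mono fun z => hpt X z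
    _ ≤ ∫⁻ X, ENNReal.ofReal (momentConst m * (σ * √L / √n) ^ m) * 2
          * totalBound (2 * k) X ^ (8 * m / n) ∂(designLaw n p) := by
        refine lintegral_mono fun X => ?_
        rw [lintegral_mul_const _ ((hmw X).const_mul _), lintegral_const_mul _ (hmw X)]
        gcongr
        exact lintegral_noiseWeight_le hσ hL X
    _ ≤ _ := by
        rw [lintegral_const_mul _ hmt]
        gcongr
        exact lintegral_totalBound_rpow_le hn (by omega) hd hL hLn (by linarith) hmn

/-! ### Number of supports and the asymptotic regime -/

/-- From `choose p d ≤ p^d / d!` and `d^d / d! ≤ exp d` with `d = 2k`, the left side is at most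
`(p/k)^(2k) exp(2k)`; then `log(p/k) ≥ 1` absorbs `exp(2k)`. -/
theorem choose_mul_two_pow_le_exp {p k : ℕ} (hk : 0 < k) (hp : 0 < p)
    (hlog : 1 ≤ Real.log (p / k)) :
    (p.choose (2 * k) : ℝ) * 2 ^ (2 * k) ≤ Real.exp (4 * (k * Real.log (p / k))) := by
  have hk' : (0 : ℝ) < k := by exact_mod_cast hk
  have hp' : (0 : ℝ) < p := by exact_mod_cast hp
  have h1 : (p.choose (2 * k) : ℝ) ≤ (p : ℝ) ^ (2 * k) / (2 * k).factorial :=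
    Nat.choose_le_pow_div _ _
  have h2 := Real.pow_div_factorial_le_exp ((2 * k : ℕ) : ℝ) (by positivity) (2 * k)
  have h3 : (p : ℝ) ^ (2 * k) / (2 * k).factorial * 2 ^ (2 * k)
      = (p / k : ℝ) ^ (2 * k) * (((2 * k : ℕ) : ℝ) ^ (2 * k) / (2 * k).factorial) := by
    push_cast
    rw [div_pow, mul_pow]
    field_simp
  calc _ ≤ (p : ℝ) ^ (2 * k) / (2 * k).factorial * 2 ^ (2 * k) := by gcongr
    _ ≤ (p / k : ℝ) ^ (2 * k) * Real.exp ((2 * k : ℕ) : ℝ) := by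
        rw [h3]; gcongr
    _ = Real.exp (2 * k * Real.log (p / k) + 2 * k) := by
        rw [← Real.exp_log (pow_pos (div_pos hp' hk') (2 * k)), ← Real.exp_add, Real.log_pow]
        push_cast; rfl
    _ ≤ _ := by
        refine Real.exp_le_exp.2 ?_
        nlinarith

end SparseRegression

theorem proposition4p2 (p k : ℕ → ℕ) (hk : ∀ n, 1 ≤ k n) (hkp : ∀ n, k n ≤ p n)
    (hsparse : Tendsto (fun n => (k n : ℝ) / (p n : ℝ)) atTop (nhds 0))
    (hrate : Tendsto (fun n => (k n : ℝ) * Real.log ((p n : ℝ) / (k n : ℝ)) / (n : ℝ))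
      atTop (nhds 0)) :
    ∀ m : ℝ, 1 ≤ m → ∃ C : ℝ, 0 < C ∧ ∀ᶠ n : ℕ in atTop,
      ∀ σ : ℝ, 0 < σ →
      ∀ est : (Fin n → Fin (p n) → ℝ) × (Fin n → ℝ) → EuclideanSpace ℝ (Fin (p n)),
        SparseRegression.IsSparseLeastSquares (k n) est →
        (⨆ β ∈ SparseRegression.sparseVectors (p n) (k n),
          (SparseRegression.errorMoment est σ m β) ^ (2 / m)) ≤
        ENNReal.ofReal
          (C * (σ ^ 2 * (k n : ℝ) * Real.log ((p n : ℝ) / (k n : ℝ)) / (n : ℝ))) := by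
  intro m hm
  have hm0 : 0 < m := by linarith
  have hG : (3 * SparseRegression.growthRate) ^ (8 * m) ≠ ∞ :=
    ENNReal.rpow_ne_top_of_nonneg (by positivity)
      (ENNReal.mul_ne_top (by simp) SparseRegression.growthRate_ne_top)
  set G : ℝ := ((3 * SparseRegression.growthRate) ^ (8 * m)).toReal with hGdef
  have hG0 : 0 ≤ G := ENNReal.toReal_nonneg
  -- The added `1` makes `A` positive whatever the value of `G`.
  set A : ℝ := SparseRegression.momentConst m * 2 * G + 1 with hA
  have hc0 : 0 < SparseRegression.momentConst m := by
    unfold SparseRegression.momentConst; positivity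
  have hA0 : 0 < A := by positivity
  refine ⟨A ^ (2 / m) * 4, by positivity, ?_⟩
  -- The threshold `exp(-1)` yields `log(p/k) ≥ 1` and, as `e > 2`, `2k ≤ p`. The threshold `1/16`
  -- yields `2k ≤ 2ℓ ≤ n/8` and `L = 4ℓ ≤ n`.
  filter_upwards [hsparse.eventually (gt_mem_nhds (Real.exp_pos (-1))),
    hrate.eventually (gt_mem_nhds (show (0 : ℝ) < 1 / 16 by norm_num)),
    eventually_ge_atTop 4, eventually_ge_atTop ⌈8 * m⌉₊] with n h1 h2 h4 h8
  intro σ hσ est hest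
  have hn' : (0 : ℝ) < n := by exact_mod_cast (by omega : 0 < n)
  have hk0 : 0 < k n := hk n
  have hk' : (1 : ℝ) ≤ k n := by exact_mod_cast hk n
  have hp0 : 0 < p n := hk0.trans_le (hkp n)
  have hp' : (0 : ℝ) < p n := by exact_mod_cast hp0
  have hratio : Real.exp 1 < (p n : ℝ) / k n := by
    rw [Real.exp_neg] at h1
    have := (inv_lt_inv₀ (by positivity) (by positivity)).2 h1
    rwa [inv_inv, inv_div] at this
  have hlog : 1 ≤ Real.log ((p n : ℝ) / k n) := by
    rw [Real.le_log_iff_exp_le (by positivity)]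
    exact hratio.le
  have h2p : 2 * k n ≤ p n := by
    have : (2 : ℝ) < (p n : ℝ) / k n := lt_trans (by linarith [Real.exp_one_gt_d9]) hratio
    rw [lt_div_iff₀ (by positivity)] at this
    exact_mod_cast this.le
  set ℓ : ℝ := (k n : ℝ) * Real.log ((p n : ℝ) / k n) with hℓ
  have hℓk : (k n : ℝ) ≤ ℓ := le_mul_of_one_le_right (by positivity) hlog
  rw [div_lt_iff₀ hn'] at h2
  have hmn : 8 * m ≤ n := Nat.ceil_le.1 h8
  refine iSup₂_le fun β hβ => ?_
  have hmain := SparseRegression.errorMoment_le (L := 4 * ℓ) h4 hk0 h2p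
    (by push_cast; linarith) (SparseRegression.choose_mul_two_pow_le_exp hk0 hp0 hlog)
    (by linarith) (by linarith) hm hmn hσ hest hβ
  have hs : 0 ≤ σ * √(4 * ℓ) / √n := by positivity
  have hle : SparseRegression.errorMoment est σ m β
      ≤ ENNReal.ofReal (A * (σ * √(4 * ℓ) / √n) ^ m) := by
    refine hmain.trans ?_
    rw [← ENNReal.ofReal_toReal hG, ← hGdef, show (2 : ℝ≥0∞) = ENNReal.ofReal 2 by simp,
      ← ENNReal.ofReal_mul (by positivity), ← ENNReal.ofReal_mul (by positivity)]
    refine ENNReal.ofReal_le_ofReal ?_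
    have : 0 ≤ (σ * √(4 * ℓ) / √n) ^ m := by positivity
    rw [hA]
    nlinarith
  refine (ENNReal.rpow_le_rpow hle (by positivity)).trans ?_
  rw [ENNReal.ofReal_rpow_of_nonneg (by positivity) (by positivity)]
  refine ENNReal.ofReal_le_ofReal (le_of_eq ?_)
  rw [Real.mul_rpow hA0.le (by positivity), ← Real.rpow_mul hs, mul_div_cancel₀ _ hm0.ne',
    Real.rpow_two, div_pow, mul_pow, Real.sq_sqrt (by linarith), Real.sq_sqrt hn'.le, hℓ]
  ring
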